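/- For an integer $q\ge 1$ let $c_q:=\sqrt{\lfloor (q+2)^2/4\rfloor}$, and let $[q]=\{1,\dots,q\}$. For integers $\ell,t\ge 0$, a word $w_1w_2\cdots w_\ell\in[q]^\ell$ is called *$t$-tail-heavy of depth $q$* if there are $n>\sqrt{\ell}$ distinct indices $i_1,\dots,i_n\in\{1,\dots,\ell\}$, all greater than $\ell-t$, such that $w_{i_1}=\dots=w_{i_n}=q$ and such that $w_x+w_y\ge q$ for all (possibly equal) indices $1\le x,y\le \ell-t$ with $x+y\in\{i_1,\dots,i_n\}$. **Theorem.** For all integers $q\ge 1$ and $\ell,t\ge 0$, the number of $t$-tail-heavy words of length $\ell$ and depth $q$ is at most $$t\,q^{t}\,c_q^{\,\ell+\sqrt{\ell}+10}.$$ -/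

import Mathlib

/-- The constant `c_q = √⌊(q+2)²/4⌋`. -/
noncomputable def depthConst (q : ℕ) : ℝ :=
  Real.sqrt (⌊((q : ℝ) + 2) ^ 2 / 4⌋₊ : ℝ)

/-- Words `w_1 ⋯ w_ℓ` of length `ℓ` over the alphabet `[q] = {1, …, q}`. -/
abbrev DepthWord (q ℓ : ℕ) : Type := Fin ℓ → Finset.Icc 1 q

/-- The position in `{1, …, ℓ}` of an index of a word of length `ℓ`:
`w i` is the letter that is written `w_x` with `x = wordPos i`. -/
def wordPos {ℓ : ℕ} (i : Fin ℓ) : ℕ := (i : ℕ) + 1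

/-- `w` is `t`-tail-heavy of depth `q`: there is a set `I` of more than `√ℓ` positions greater than
`ℓ - t` at which `w` has the letter `q`, such that `w_x + w_y ≥ q` for all positions
`x, y ≤ ℓ - t` (possibly equal) with `x + y ∈ I`.
The comparisons with `ℓ - t` are written without subtraction. -/
def IsTailHeavy {q ℓ : ℕ} (t : ℕ) (w : DepthWord q ℓ) : Prop :=
  ∃ I : Finset (Fin ℓ),
    Real.sqrt (ℓ : ℝ) < (I.card : ℝ) ∧
    (∀ i ∈ I, ℓ < wordPos i + t ∧ (w i : ℕ) = q) ∧
    ∀ x y : Fin ℓ, wordPos x + t ≤ ℓ → wordPos y + t ≤ ℓ →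
      (∃ i ∈ I, wordPos x + wordPos y = wordPos i) → q ≤ (w x : ℕ) + (w y : ℕ)

/-! Write ℓ = L + t and fix a set J, of size n > √ℓ, of tail offsets that carry the letter q. Given
the first half f of the first L letters, each of the last M ≈ L/2 - t of these L letters, at
distance j from their end, is constrained by f on the translate J + j. Every translate has size n
and every position lies in at most n of them, so Finner's inequality (`expect_prod_le_of_cover`)
bounds the average of the product of the numbers of admissible letters by their n-th moments.
Splitting on the minimum m of f on a translate bounds such a moment by q (c_q²/q)ⁿ, because
(m+1)(q+1-m) ≤ c_q² (`expect_card_compatibleLetters_pow_le`). So each of the M letters, paired with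
one from the first half, contributes c_q² up to a loss q^(1/n); the total loss q^(M/n) is at most
c_q^√ℓ since n > √ℓ. The sum over J gives at most (q+1)^t, which `depth_bound_le` absorbs. -/

/-! ### Hölder and Finner inequalities for finite averages. -/

section HolderFinner

open Finset
open scoped BigOperators

/-- Hölder's inequality for averages, with at most `n` factors. -/
theorem expect_prod_rpow_le {ι κ : Type*} [Fintype κ] [Nonempty κ]
    (s : Finset ι) (n : ℕ) (hn : 0 < n) (hs : s.card ≤ n) (G : ι → κ → ℝ)
    (hG : ∀ i v, 0 ≤ G i v) :
    𝔼 v, ∏ i ∈ s, G i v ^ (1 / n : ℝ) ≤ ∏ i ∈ s, (𝔼 v, G i v) ^ (1 / n : ℝ) := by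
  have hn' : (0 : ℝ) < n := by exact_mod_cast hn
  by_cases hz : ∃ i ∈ s, 𝔼 v, G i v = 0
  · obtain ⟨i, hi, h0⟩ := hz
    have h1 : ∀ v, G i v = 0 := by
      intro v
      have := (Finset.expect_eq_zero_iff_of_nonneg (fun v _ => hG i v)).1 h0
      exact this v (mem_univ v)
    have h2 : ∀ v, ∏ i ∈ s, G i v ^ (1 / n : ℝ) = 0 := by
      intro v
      refine Finset.prod_eq_zero hi ?_
      rw [h1 v, Real.zero_rpow (by positivity)]
    simp only [h2, Finset.expect_const_zero]
    exact Finset.prod_nonneg fun i _ => Real.rpow_nonneg (Finset.expect_nonneg fun v _ => hG i v) _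
  push Not at hz
  have hpos : ∀ i ∈ s, 0 < 𝔼 v, G i v := fun i hi =>
    lt_of_le_of_ne (Finset.expect_nonneg fun v _ => hG i v) (Ne.symm (hz i hi))
  have hc : (s.card : ℝ) ≤ n := by exact_mod_cast hs
  have key : ∀ v, ∏ i ∈ s, (G i v / 𝔼 u, G i u) ^ (1 / n : ℝ) ≤
      ∑ i ∈ s, (1 / n : ℝ) * (G i v / 𝔼 u, G i u) + (1 - s.card / n : ℝ) := by
    intro v
    -- The extra index `none` carries the value 1 and the missing weight 1 - |s|/n.
    have := Real.geom_mean_le_arith_mean_weighted (insertNone s)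
      (fun o => o.elim (1 - s.card / n : ℝ) (fun _ => (1 / n : ℝ)))
      (fun o => o.elim 1 (fun i => G i v / 𝔼 u, G i u)) ?_ ?_ ?_
    · simpa [prod_insertNone, sum_insertNone, add_comm] using this
    · rintro (_ | i) _
      · simp only [Option.elim_none]
        rw [sub_nonneg, div_le_one hn']; exact hc
      · simp
    · simp [sum_insertNone]; ring
    · rintro (_ | i) hi
      · simp
      · simp only [Option.elim_some]
        exact div_nonneg (hG i v) (Finset.expect_nonneg fun v _ => hG i v)
  have hsplit : ∀ v, ∏ i ∈ s, G i v ^ (1 / n : ℝ) =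
      (∏ i ∈ s, (𝔼 u, G i u) ^ (1 / n : ℝ)) * ∏ i ∈ s, (G i v / 𝔼 u, G i u) ^ (1 / n : ℝ) := by
    intro v
    rw [← Finset.prod_mul_distrib]
    refine Finset.prod_congr rfl fun i hi => ?_
    rw [← Real.mul_rpow (hpos i hi).le (div_nonneg (hG i v) (hpos i hi).le),
      mul_div_cancel₀ _ (hpos i hi).ne']
  simp only [hsplit]
  rw [← Finset.mul_expect]
  refine mul_le_of_le_one_right
    (Finset.prod_nonneg fun i hi => Real.rpow_nonneg (hpos i hi).le _) ?_
  refine (Finset.expect_le_expect fun v _ => key v).trans (le_of_eq ?_)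
  rw [Finset.expect_add_distrib, Finset.expect_const univ_nonempty, Finset.expect_sum_comm]
  have : ∀ i ∈ s, 𝔼 v, (1 / n : ℝ) * (G i v / 𝔼 u, G i u) = 1 / n := by
    intro i hi
    rw [← Finset.mul_expect, ← Finset.expect_div, div_self (hpos i hi).ne', mul_one]
  rw [Finset.sum_congr rfl this]
  simp
  ring

theorem expect_fin_cons {κ : Type*} [Fintype κ] (k : ℕ) (G : (Fin (k + 1) → κ) → ℝ) :
    𝔼 f, G f = 𝔼 v : κ, 𝔼 f : Fin k → κ, G (Fin.cons v f) := by
  rw [← Finset.expect_product', univ_product_univ]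
  exact (Fintype.expect_equiv (Fin.consEquiv fun _ => κ) _ _ fun _ => rfl).symm

/-- Finner's inequality for averages over a finite cube: if every coordinate matters to at most `n`
of the functions `F i`, then `𝔼 ∏ F i ≤ ∏ (𝔼 F i ^ n) ^ (1 / n)`. -/
theorem expect_prod_le_of_cover {ι κ : Type*} [Fintype κ] [Nonempty κ]
    (s : Finset ι) (n : ℕ) (hn : 0 < n) (k : ℕ) (S : ι → Finset (Fin k))
    (F : ι → (Fin k → κ) → ℝ) (hF0 : ∀ i f, 0 ≤ F i f)
    (hF : ∀ i f g, (∀ a ∈ S i, f a = g a) → F i f = F i g)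
    (hcov : ∀ a, (s.filter fun i => a ∈ S i).card ≤ n) :
    𝔼 f, ∏ i ∈ s, F i f ≤ ∏ i ∈ s, (𝔼 f, F i f ^ n) ^ (1 / n : ℝ) := by
  induction k with
  | zero =>
    simp only [univ_unique, expect_singleton]
    refine le_of_eq (Finset.prod_congr rfl fun i _ => ?_)
    rw [one_div, Real.pow_rpow_inv_natCast (hF0 i _) hn.ne']
  | succ k ih =>
    have h1 : ∀ v : κ, 𝔼 f : Fin k → κ, ∏ i ∈ s, F i (Fin.cons v f) ≤
        ∏ i ∈ s, (𝔼 f : Fin k → κ, F i (Fin.cons v f) ^ n) ^ (1 / n : ℝ) := by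
      intro v
      refine ih (fun i => univ.filter fun a => a.succ ∈ S i) (fun i f => F i (Fin.cons v f))
        (fun i f => hF0 i _) ?_ ?_
      · intro i f g hfg
        refine hF i _ _ fun a ha => ?_
        cases a using Fin.cases with
        | zero => rfl
        | succ a => simpa using hfg a (by simpa using ha)
      · intro a
        simpa using hcov a.succ
    rw [expect_fin_cons]
    refine (Finset.expect_le_expect fun v _ => h1 v).trans ?_
    simp only [expect_fin_cons (G := fun f => F _ f ^ n)]
    have hnn : ∀ i (v : κ), 0 ≤ 𝔼 f : Fin k → κ, F i (Fin.cons v f) ^ n := fun i v =>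
      Finset.expect_nonneg fun f _ => pow_nonneg (hF0 _ _) _
    have hconst : ∀ i, 0 ∉ S i → ∀ v u : κ, 𝔼 f : Fin k → κ, F i (Fin.cons v f) ^ n =
        𝔼 f : Fin k → κ, F i (Fin.cons u f) ^ n := by
      intro i hi v u
      refine Finset.expect_congr rfl fun f _ => ?_
      rw [hF i (Fin.cons v f) (Fin.cons u f)]
      intro a ha
      cases a using Fin.cases with
      | zero => exact absurd ha hi
      | succ a => rfl
    have h2 : ∀ v : κ, ∏ i ∈ s, (𝔼 f : Fin k → κ, F i (Fin.cons v f) ^ n) ^ (1 / n : ℝ) =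
        (∏ i ∈ s with 0 ∈ S i, (𝔼 f : Fin k → κ, F i (Fin.cons v f) ^ n) ^ (1 / n : ℝ)) *
        ∏ i ∈ s with 0 ∉ S i,
          (𝔼 u : κ, 𝔼 f : Fin k → κ, F i (Fin.cons u f) ^ n) ^ (1 / n : ℝ) := by
      intro v
      rw [← Finset.prod_filter_mul_prod_filter_not s (fun i => 0 ∈ S i)]
      congr 1
      refine Finset.prod_congr rfl fun i hi => ?_
      rw [Finset.expect_congr rfl fun u _ => hconst i (mem_filter.1 hi).2 u v,
        Finset.expect_const univ_nonempty]
    -- Factors that do not depend on the new coordinate leave the average; Hölder handles the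
    -- others, at most n by `hcov 0`.
    simp only [h2]
    rw [← Finset.expect_mul, ← Finset.prod_filter_mul_prod_filter_not s (fun i => 0 ∈ S i)]
    refine mul_le_mul_of_nonneg_right ?_ ?_
    · exact expect_prod_rpow_le _ n hn (hcov 0) _ hnn
    · exact Finset.prod_nonneg fun i _ =>
        Real.rpow_nonneg (Finset.expect_nonneg fun v _ => hnn i v) _

end HolderFinner

/-! ### Numerical estimates for c_q. -/

theorem sq_depthConst (q : ℕ) : depthConst q ^ 2 = (⌊((q : ℝ) + 2) ^ 2 / 4⌋₊ : ℝ) :=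
  Real.sq_sqrt (Nat.cast_nonneg _)

theorem depthConst_nonneg (q : ℕ) : 0 ≤ depthConst q := Real.sqrt_nonneg _

theorem mul_le_sq_depthConst {q m : ℕ} (hm : m ≤ q + 1) :
    ((m : ℝ) + 1) * ((q + 1 - m : ℕ) : ℝ) ≤ depthConst q ^ 2 := by
  rw [sq_depthConst]
  have : (m + 1) * (q + 1 - m) ≤ ⌊((q : ℝ) + 2) ^ 2 / 4⌋₊ := by
    refine Nat.le_floor ?_
    push_cast [Nat.cast_sub hm]
    nlinarith [sq_nonneg ((q : ℝ) - 2 * m)]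
  exact_mod_cast this

/-- The floor loses at most 1/4, and (q+2)² - 1 = (q+1)(q+3). -/
theorem le_four_mul_sq_depthConst (q : ℕ) :
    ((q : ℝ) + 1) * (q + 3) ≤ 4 * depthConst q ^ 2 := by
  rcases Nat.even_or_odd' q with ⟨m, rfl | rfl⟩
  · have := mul_le_sq_depthConst (q := 2 * m) (m := m) (by omega)
    rw [Nat.cast_sub (by omega)] at this
    push_cast at this ⊢
    nlinarith
  · have := mul_le_sq_depthConst (q := 2 * m + 1) (m := m) (by omega)
    rw [Nat.cast_sub (by omega)] at this
    push_cast at this ⊢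
    nlinarith

theorem le_sq_depthConst (q : ℕ) : (q : ℝ) ≤ depthConst q ^ 2 := by
  have := le_four_mul_sq_depthConst q
  nlinarith [sq_nonneg ((q : ℝ))]

theorem one_le_depthConst {q : ℕ} (hq : 1 ≤ q) : 1 ≤ depthConst q := by
  have h := le_sq_depthConst q
  have : (1 : ℝ) ≤ q := by exact_mod_cast hq
  nlinarith [depthConst_nonneg q]

theorem depthConst_le {q : ℕ} (hq : 2 ≤ q) : depthConst q ≤ q := by
  have h : (2 : ℝ) ≤ q := by exact_mod_cast hq
  have h2 : depthConst q ^ 2 ≤ (q : ℝ) ^ 2 := by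
    rw [sq_depthConst]
    refine (Nat.floor_le (by positivity)).trans ?_
    nlinarith
  exact (pow_le_pow_iff_left₀ (depthConst_nonneg q) (by positivity) two_ne_zero).1 h2

/-- Absorbs the factor (q+1)^t from the sum over J. After squaring, it suffices that 64q² ≤
(q+1)(q+3)³. -/
theorem mul_succ_le_depthConst_cube (q : ℕ) :
    ((q : ℝ) + 1) * q ≤ depthConst q ^ 3 := by
  have h := le_four_mul_sq_depthConst q
  have h0 : (0 : ℝ) ≤ q := Nat.cast_nonneg q
  refine (pow_le_pow_iff_left₀ (by positivity) (pow_nonneg (depthConst_nonneg q) 3)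
    two_ne_zero).1 ?_
  have h3 : (((q : ℝ) + 1) * (q + 3)) ^ 3 ≤ (4 * depthConst q ^ 2) ^ 3 := by gcongr
  have h4 : 64 * (((q : ℝ) + 1) * q) ^ 2 ≤ (((q : ℝ) + 1) * (q + 3)) ^ 3 := by
    have e1 : (12 * q : ℝ) ≤ (q + 3) ^ 2 := by nlinarith [sq_nonneg ((q : ℝ) - 3)]
    have e2 : (6 * q : ℝ) ≤ (q + 1) * (q + 3) := by nlinarith [sq_nonneg ((q : ℝ) - 1)]
    have e3 : (12 * q : ℝ) * (6 * q) ≤ (q + 3) ^ 2 * ((q + 1) * (q + 3)) := by gcongr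
    have e4 : ((q : ℝ) + 1) ^ 2 * ((12 * q : ℝ) * (6 * q)) ≤
      (q + 1) ^ 2 * ((q + 3) ^ 2 * ((q + 1) * (q + 3))) := by gcongr
    nlinarith [sq_nonneg (((q : ℝ) + 1) * q)]
  nlinarith

/-- The final comparison of exponents. -/
theorem depth_bound_le {q L t M : ℕ} {r x : ℝ} (hq : 2 ≤ q) (ht : 1 ≤ t) (hr : 0 ≤ r)
    (hx : x ≤ r / 2) (hLM : 2 * M ≤ L) (hLt : L ≤ 2 * M + 2 * t) :
    ((q : ℝ) + 1) ^ t * ((q : ℝ) ^ (L - 2 * M) * ((q : ℝ) ^ x * depthConst q ^ (2 * M))) ≤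
      (t : ℝ) * (q : ℝ) ^ t * depthConst q ^ (((L + t : ℕ) : ℝ) + r + 10) := by
  set c := depthConst q with hc
  have hc1 : 1 ≤ c := one_le_depthConst (by omega)
  have hcq : c ≤ q := depthConst_le hq
  have hq1 : (1 : ℝ) ≤ q := hc1.trans hcq
  have h1 : (q : ℝ) ^ x ≤ c ^ r := by
    calc (q : ℝ) ^ x ≤ (q : ℝ) ^ (r / 2) := Real.rpow_le_rpow_of_exponent_le hq1 hx
      _ ≤ (c ^ 2) ^ (r / 2) := Real.rpow_le_rpow (by positivity) (le_sq_depthConst q) (by positivity)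
      _ = c ^ r := by
        rw [← Real.rpow_natCast, ← Real.rpow_mul (by positivity)]; congr 1; push_cast; ring
  have h2 : ((q : ℝ) + 1) ^ t * ((q : ℝ) ^ (L - 2 * M) * c ^ (2 * M)) ≤ (q : ℝ) ^ t * c ^ (L + t) := by
    -- Multiplying by c^e ≤ q^e completes q^(L-2M) to q^(2t), so that t factors (q+1)q can be
    -- formed.
    obtain ⟨e, he⟩ : ∃ e, L - 2 * M + e = 2 * t := ⟨2 * t - (L - 2 * M), by omega⟩
    have hce : 0 < c ^ e := by positivity
    refine le_of_mul_le_mul_right ?_ hce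
    calc ((q : ℝ) + 1) ^ t * ((q : ℝ) ^ (L - 2 * M) * c ^ (2 * M)) * c ^ e
        ≤ ((q : ℝ) + 1) ^ t * ((q : ℝ) ^ (L - 2 * M) * c ^ (2 * M)) * (q : ℝ) ^ e := by gcongr
      _ = (q : ℝ) ^ t * (((q : ℝ) + 1) * q) ^ t * c ^ (2 * M) := by
        rw [mul_pow]
        have : (q : ℝ) ^ (L - 2 * M) * (q : ℝ) ^ e = (q : ℝ) ^ t * (q : ℝ) ^ t := by
          rw [← pow_add, he, two_mul, pow_add]
        linear_combination ((q : ℝ) + 1) ^ t * c ^ (2 * M) * this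
      _ ≤ (q : ℝ) ^ t * (c ^ 3) ^ t * c ^ (2 * M) := by
        gcongr; exact mul_succ_le_depthConst_cube q
      _ = (q : ℝ) ^ t * c ^ (L + t) * c ^ e := by
        rw [← pow_mul, mul_assoc, mul_assoc, ← pow_add, ← pow_add]
        congr 2; omega
  have h3 : c ^ (L + t) * c ^ r ≤ c ^ (((L + t : ℕ) : ℝ) + r + 10) := by
    rw [← Real.rpow_natCast c (L + t), ← Real.rpow_add (by positivity)]
    exact Real.rpow_le_rpow_of_exponent_le hc1 (by linarith)
  have ht' : (1 : ℝ) ≤ t := by exact_mod_cast ht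
  calc _ = (((q : ℝ) + 1) ^ t * ((q : ℝ) ^ (L - 2 * M) * c ^ (2 * M))) * (q : ℝ) ^ x := by ring
    _ ≤ ((q : ℝ) ^ t * c ^ (L + t)) * c ^ r := by gcongr
    _ = (q : ℝ) ^ t * (c ^ (L + t) * c ^ r) := by ring
    _ ≤ (q : ℝ) ^ t * c ^ (((L + t : ℕ) : ℝ) + r + 10) := by gcongr
    _ ≤ (t : ℝ) * ((q : ℝ) ^ t * c ^ (((L + t : ℕ) : ℝ) + r + 10)) :=
      le_mul_of_one_le_left (by positivity) ht'
    _ = _ := by ring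

/-! ### Moments of the number of compatible letters. -/

section Counting

open Finset
open scoped BigOperators

/-- The letters `v` with `f a + v ≥ q` for all `a ∈ S`. -/
def compatibleLetters {q h : ℕ} (S : Finset (Fin h)) (f : DepthWord q h) :
    Finset (Finset.Icc 1 q) :=
  univ.filter fun v => ∀ a ∈ S, q ≤ (f a : ℕ) + v

theorem card_letters_ge {q m : ℕ} (hm : 1 ≤ m) :
    (univ.filter fun v : Finset.Icc 1 q => m ≤ (v : ℕ)).card = q + 1 - m := by
  rw [← Nat.card_Icc m q, ← Finset.card_map (Function.Embedding.subtype _)]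
  congr 1
  ext x
  simp only [mem_map, mem_filter, mem_univ, true_and, Function.Embedding.subtype_apply,
    Subtype.exists, mem_Icc, exists_and_left, exists_prop, exists_eq_right_right]
  omega

theorem card_compatibleLetters_le {q h : ℕ} (S : Finset (Fin h)) (f : DepthWord q h)
    {a : Fin h} (ha : a ∈ S) : (compatibleLetters S f).card ≤ (f a : ℕ) + 1 := by
  have h1 : 1 ≤ (f a : ℕ) := (mem_Icc.1 (f a).2).1
  have h2 : (f a : ℕ) ≤ q := (mem_Icc.1 (f a).2).2
  have hsub : compatibleLetters S f ⊆
      univ.filter fun v : Finset.Icc 1 q => max 1 (q - f a) ≤ (v : ℕ) := by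
    intro v hv
    have h3 := (mem_filter.1 hv).2 a ha
    have h4 := (mem_Icc.1 v.2).1
    simp only [mem_filter, mem_univ, true_and]
    omega
  refine (card_le_card hsub).trans ?_
  rw [card_letters_ge (le_max_left _ _)]
  omega

theorem card_words_ge {q h m : ℕ} (hm : 1 ≤ m) (S : Finset (Fin h)) :
    (univ.filter fun f : DepthWord q h => ∀ a ∈ S, m ≤ (f a : ℕ)).card =
      (q + 1 - m) ^ S.card * q ^ (h - S.card) := by
  have : (univ.filter fun f : DepthWord q h => ∀ a ∈ S, m ≤ (f a : ℕ)) =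
      Fintype.piFinset fun a => if a ∈ S then univ.filter (fun v : Finset.Icc 1 q => m ≤ (v : ℕ))
        else univ := by
    ext f
    simp only [mem_filter, mem_univ, true_and, Fintype.mem_piFinset]
    refine forall_congr' fun a => ?_
    by_cases ha : a ∈ S <;> simp [ha]
  rw [this, Fintype.card_piFinset]
  have h2 : ∀ a : Fin h, (if a ∈ S then univ.filter (fun v : Finset.Icc 1 q => m ≤ (v : ℕ))
      else univ).card = if a ∈ S then q + 1 - m else q := by
    intro a
    split_ifs
    · exact card_letters_ge hm
    · simp
  rw [prod_congr rfl fun a _ => h2 a, prod_ite]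
  simp [filter_not, card_sdiff]

/-- If m is the minimum of f on S, at most m+1 letters are compatible, while at most (q+1-m)^|S|
patterns on S have all letters ≥ m. The factor q counts the values of m. -/
theorem expect_card_compatibleLetters_pow_le {q h : ℕ} (hq : 1 ≤ q) (S : Finset (Fin h))
    (hS : S.Nonempty) :
    𝔼 f : DepthWord q h, ((compatibleLetters S f).card : ℝ) ^ S.card ≤
      q * (depthConst q ^ 2 / q) ^ S.card := by
  have hq' : (0 : ℝ) < q := by exact_mod_cast hq
  have : Nonempty (Finset.Icc 1 q) := ⟨⟨1, mem_Icc.2 ⟨le_rfl, hq⟩⟩⟩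
  set n := S.card with hn
  have hnh : n ≤ h := by simpa using card_le_univ S
  have key : ∑ f : DepthWord q h, ((compatibleLetters S f).card : ℝ) ^ n ≤
      ∑ m : Finset.Icc 1 q, ∑ f : DepthWord q h with ∀ a ∈ S, (m : ℕ) ≤ f a,
        ((m : ℝ) + 1) ^ n := by
    simp only [sum_filter]
    rw [sum_comm]
    refine sum_le_sum fun f _ => ?_
    obtain ⟨a, ha, hmin⟩ := exists_min_image S (fun a => (f a : ℕ)) hS
    refine le_trans ?_ (single_le_sum (f := fun m : Finset.Icc 1 q =>
      if ∀ a ∈ S, (m : ℕ) ≤ f a then ((m : ℝ) + 1) ^ n else 0) (fun m _ => ?_) (mem_univ (f a)))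
    · rw [if_pos hmin]
      gcongr
      exact_mod_cast card_compatibleLetters_le S f ha
    · split_ifs <;> positivity
  rw [Fintype.expect_eq_sum_div_card, div_le_iff₀ (Nat.cast_pos.2 Fintype.card_pos)]
  refine key.trans ?_
  have hm : ∀ m : Finset.Icc 1 q, ∑ f : DepthWord q h with ∀ a ∈ S, (m : ℕ) ≤ f a,
      ((m : ℝ) + 1) ^ n ≤ (depthConst q ^ 2) ^ n * q ^ (h - n) := by
    intro m
    obtain ⟨m, hm⟩ := m
    rw [mem_Icc] at hm
    rw [sum_const, card_words_ge hm.1, nsmul_eq_mul, Nat.cast_mul, Nat.cast_pow, Nat.cast_pow,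
      mul_right_comm, ← mul_pow, ← hn]
    gcongr
    rw [mul_comm]
    exact mul_le_sq_depthConst (hm.2.trans (Nat.le_succ q))
  refine (sum_le_sum fun m _ => hm m).trans (le_of_eq ?_)
  simp only [sum_const, card_univ, Fintype.card_coe, Nat.card_Icc, nsmul_eq_mul,
    Fintype.card_fun, Fintype.card_fin, Nat.add_sub_cancel]
  have hp : (q : ℝ) ^ h = q ^ n * q ^ (h - n) := by rw [← pow_add, Nat.add_sub_cancel' hnh]
  rw [div_pow]
  push_cast
  rw [hp]
  field_simp

/-- Finner's inequality applied to the numbers of compatible letters. -/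
theorem sum_prod_card_compatibleLetters_le {q h n M : ℕ} (hq : 1 ≤ q) (hn : 0 < n)
    (hM : M ≤ h) (S : ℕ → Finset (Fin h)) (hS : ∀ j < M, (S j).card = n)
    (hcov : ∀ a, ((range M).filter fun j => a ∈ S j).card ≤ n) :
    ∑ f : DepthWord q h, ∏ j ∈ range M, ((compatibleLetters (S j) f).card : ℝ) ≤
      q ^ (h - M) * (q ^ ((M : ℝ) / n) * depthConst q ^ (2 * M)) := by
  have hq' : (0 : ℝ) < q := by exact_mod_cast hq
  have : Nonempty (Finset.Icc 1 q) := ⟨⟨1, mem_Icc.2 ⟨le_rfl, hq⟩⟩⟩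
  have h1 := expect_prod_le_of_cover (κ := Finset.Icc 1 q) (range M) n hn h S
    (fun j f => ((compatibleLetters (S j) f).card : ℝ)) (fun _ _ => Nat.cast_nonneg _) ?_ hcov
  swap
  · intro j f g hfg
    have : compatibleLetters (S j) f = compatibleLetters (S j) g :=
      filter_congr fun v _ => forall₂_congr fun a ha => by rw [hfg a ha]
    simp only [this]
  have h2 : ∏ j ∈ range M, (𝔼 f : DepthWord q h,
      ((compatibleLetters (S j) f).card : ℝ) ^ n) ^ (1 / n : ℝ) ≤
      ∏ j ∈ range M, ((q : ℝ) ^ (1 / n : ℝ) * (depthConst q ^ 2 / q)) := by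
    refine prod_le_prod (fun j _ => by
      exact Real.rpow_nonneg (Finset.expect_nonneg fun _ _ => by positivity) _) fun j hj => ?_
    have hj' := hS j (mem_range.1 hj)
    have := expect_card_compatibleLetters_pow_le hq (S j) (card_pos.1 (hj' ▸ hn))
    rw [hj'] at this
    refine (Real.rpow_le_rpow (Finset.expect_nonneg fun _ _ => by positivity) this
      (by positivity)).trans (le_of_eq ?_)
    rw [Real.mul_rpow hq'.le (by positivity), one_div, Real.pow_rpow_inv_natCast (by positivity)
      hn.ne']
  have h3 := h1.trans h2
  rw [Fintype.expect_eq_sum_div_card, div_le_iff₀ (Nat.cast_pos.2 Fintype.card_pos)] at h3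
  refine h3.trans (le_of_eq ?_)
  simp only [prod_const, card_range, Fintype.card_fun, Fintype.card_fin, Fintype.card_coe,
    Nat.card_Icc, Nat.add_sub_cancel]
  have hp : (q : ℝ) ^ h = q ^ M * q ^ (h - M) := by rw [← pow_add, Nat.add_sub_cancel' hM]
  rw [mul_pow, div_pow, ← pow_mul, ← Real.rpow_natCast ((q : ℝ) ^ _),
    ← Real.rpow_mul hq'.le, one_div_mul_eq_div]
  push_cast
  rw [hp]
  field_simp

end Counting

/-! ### Reduction of tail-heavy words to the moment bound. -/

section TailHeavy

open Finset

/-- The elements of `J + j` as indices of a word of length `h`. -/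
def shiftedIndices (h : ℕ) (J : Finset ℕ) (j : ℕ) : Finset (Fin h) :=
  univ.filter fun a => ∃ x ∈ J, (a : ℕ) = x + j

theorem card_shiftedIndices {h j : ℕ} {J : Finset ℕ} (hJ : ∀ x ∈ J, x + j < h) :
    (shiftedIndices h J j).card = J.card := by
  rw [← card_map Fin.valEmbedding, ← card_map (addRightEmbedding j) (s := J)]
  congr 1
  ext y
  simp only [shiftedIndices, mem_map, mem_filter, mem_univ, true_and, Fin.valEmbedding_apply,
    addRightEmbedding_apply]
  constructor
  · rintro ⟨a, ⟨x, hx, hax⟩, rfl⟩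
    exact ⟨x, hx, hax.symm⟩
  · rintro ⟨x, hx, rfl⟩
    exact ⟨⟨x + j, hJ x hx⟩, ⟨x, hx, rfl⟩, rfl⟩

/-- This is the covering hypothesis of Finner's inequality: j ↦ a - j injects these shifts into J.
-/
theorem card_filter_mem_shiftedIndices_le {h : ℕ} (J : Finset ℕ) (s : Finset ℕ) (a : Fin h) :
    (s.filter fun j => a ∈ shiftedIndices h J j).card ≤ J.card := by
  refine card_le_card_of_injOn (fun j => a - j) ?_ ?_
  · intro j hj
    obtain ⟨x, hx, hax⟩ := (mem_filter.1 (mem_filter.1 hj).2).2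
    have : (a : ℕ) - j = x := by omega
    simpa [this] using hx
  · intro j hj k hk hjk
    obtain ⟨x, hx, hax⟩ := (mem_filter.1 (mem_filter.1 hj).2).2
    obtain ⟨y, hy, hay⟩ := (mem_filter.1 (mem_filter.1 hk).2).2
    simp only at hjk
    omega

open Classical in
/-- Words of length `L + t` whose tail positions `L + x`, `x ∈ J`, (counted from zero) carry the
letter `q` and whose first `L` letters satisfy the corresponding inequalities. -/
noncomputable def wordsWithTail (q L t : ℕ) (J : Finset ℕ) : Finset (DepthWord q (L + t)) :=
  univ.filter fun w => (∀ k : Fin (L + t), L ≤ k → (k : ℕ) - L ∈ J → (w k : ℕ) = q) ∧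
    ∀ i j : Fin (L + t), i < L → j < L → (i : ℕ) + j + 1 - L ∈ J → L ≤ (i : ℕ) + j + 1 →
      q ≤ (w i : ℕ) + w j

theorem exists_mem_wordsWithTail {q L t : ℕ} {w : DepthWord q (L + t)} (hw : IsTailHeavy t w) :
    ∃ J ∈ (range t).powerset, Real.sqrt ((L + t : ℕ) : ℝ) < J.card ∧
      w ∈ wordsWithTail q L t J := by
  obtain ⟨I, hI, hIq, hIw⟩ := hw
  have hge : ∀ i ∈ I, L ≤ (i : ℕ) := fun i hi => by
    have := (hIq i hi).1
    unfold wordPos at this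
    omega
  have hinj : Set.InjOn (fun i : Fin (L + t) => (i : ℕ) - L) I := by
    intro i hi j hj hij
    have h1 := hge i hi
    have h2 := hge j hj
    simp only at hij
    exact Fin.ext (by omega)
  refine ⟨I.image fun i : Fin (L + t) => (i : ℕ) - L, ?_, ?_, ?_⟩
  · rw [mem_powerset]
    intro x hx
    obtain ⟨i, hi, rfl⟩ := mem_image.1 hx
    have h1 := hge i hi
    have h2 := i.2
    rw [mem_range]
    omega
  · rwa [card_image_of_injOn hinj]
  · simp only [wordsWithTail, mem_filter, mem_univ, true_and]
    constructor
    · intro k hk hkI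
      obtain ⟨i, hi, hik⟩ := mem_image.1 hkI
      have h1 := hge i hi
      have : i = k := Fin.ext (by omega)
      exact this ▸ (hIq i hi).2
    · intro i j hi hj hij hL
      obtain ⟨k, hk, hkij⟩ := mem_image.1 hij
      have h1 := hge k hk
      -- The positions i+1 and j+1 add up to i+j+2, which is the index i+j+1 counted from zero.
      refine hIw i j ?_ ?_ ⟨k, hk, ?_⟩ <;> unfold wordPos <;> omega

/-- Number of admissible letters at position `i` (counted from zero), given that the first half
of the first `L` letters is `f`. -/
def letterCount {q h : ℕ} (L M : ℕ) (J : Finset ℕ) (f : DepthWord q h) (i : ℕ) : ℕ :=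
  if i < h then 1 else if i < L - M then q else if i < L then
    (compatibleLetters (shiftedIndices h J (L - 1 - i)) f).card else if i - L ∈ J then 1 else q

/-- Over each f the fibre lies in a product set once all inequalities are dropped except those
between f and the last M of the first L letters. -/
theorem card_wordsWithTail_le_sum {q L t h : ℕ} (M : ℕ) (J : Finset ℕ) (hh : h ≤ L) :
    (wordsWithTail q L t J).card ≤
      ∑ f : DepthWord q h, ∏ i : Fin (L + t), letterCount L M J f i := by
  classical
  have hle : h ≤ L + t := hh.trans (Nat.le_add_right _ _)
  rw [card_eq_sum_card_fiberwise (t := univ)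
    (f := fun w : DepthWord q (L + t) => (fun i => w (Fin.castLE hle i) : DepthWord q h))
    (fun _ _ => mem_univ _)]
  refine sum_le_sum fun f _ => ?_
  have hsub : ((wordsWithTail q L t J).filter fun w => (fun i => w (Fin.castLE hle i)) = f) ⊆
      Fintype.piFinset fun i : Fin (L + t) =>
        if hi : (i : ℕ) < h then {f ⟨i, hi⟩} else if (i : ℕ) < L - M then univ else
        if (i : ℕ) < L then compatibleLetters (shiftedIndices h J (L - 1 - i)) f else
        if (i : ℕ) - L ∈ J then univ.filter fun v : Finset.Icc 1 q => (v : ℕ) = q else univ := by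
    intro w hw
    obtain ⟨hw, hwf⟩ := mem_filter.1 hw
    obtain ⟨hw1, hw2⟩ := (mem_filter.1 hw).2
    rw [Fintype.mem_piFinset]
    intro i
    split_ifs with h1 h2 h3 h4
    · rw [mem_singleton, ← hwf]; rfl
    · exact mem_univ _
    · simp only [compatibleLetters, mem_filter, mem_univ, true_and]
      intro a ha
      obtain ⟨x, hx, hax⟩ := (mem_filter.1 ha).2
      have ha2 := a.2
      rw [← hwf]
      refine hw2 (Fin.castLE hle a) i ?_ h3 ?_ ?_
      · simp only [Fin.val_castLE]; omega
      · have : ((Fin.castLE hle a : Fin (L + t)) : ℕ) + i + 1 - L = x := by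
          simp only [Fin.val_castLE]; omega
        rwa [this]
      · simp only [Fin.val_castLE]; omega
    · simp only [mem_filter, mem_univ, true_and]
      exact hw1 i (by omega) h4
    · exact mem_univ _
  refine (card_le_card hsub).trans ?_
  rw [Fintype.card_piFinset]
  refine prod_le_prod' fun i _ => ?_
  unfold letterCount
  split_ifs
  · simp
  · simp
  · rfl
  · refine card_le_one.2 fun a ha b hb => Subtype.ext ?_
    rw [(mem_filter.1 ha).2, (mem_filter.1 hb).2]
  · simp

theorem prod_letterCount {q L t h M : ℕ} {J : Finset ℕ} (hJ : J ⊆ range t) (hM : h + M ≤ L)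
    (f : DepthWord q h) :
    ∏ i : Fin (L + t), letterCount L M J f i =
      q ^ (L - M - h) * (∏ j ∈ range M, (compatibleLetters (shiftedIndices h J j) f).card) *
        q ^ (t - J.card) := by
  rw [Fin.prod_univ_eq_prod_range (letterCount L M J f) (L + t), prod_range_add]
  have hL : L = h + (L - M - h) + M := by omega
  have e1 : ∏ i ∈ range L, letterCount L M J f i =
      q ^ (L - M - h) *
        ∏ j ∈ range M, (compatibleLetters (shiftedIndices h J j) f).card := by
    conv_lhs => rw [show range L = range (h + (L - M - h) + M) by rw [← hL]]
    rw [prod_range_add, prod_range_add, ← prod_range_reflect _ M]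
    have a1 : ∏ i ∈ range h, letterCount L M J f i = 1 :=
      prod_eq_one fun i hi => if_pos (mem_range.1 hi)
    have a2 : ∏ i ∈ range (L - M - h), letterCount L M J f (h + i) = q ^ (L - M - h) := by
      rw [← card_range (L - M - h), ← prod_const]
      simp only [card_range]
      refine prod_congr rfl fun i hi => ?_
      rw [mem_range] at hi
      unfold letterCount
      rw [if_neg (by omega), if_pos (by omega)]
    rw [a1, a2, one_mul]
    congr 1
    refine prod_congr rfl fun i hi => ?_
    rw [mem_range] at hi
    unfold letterCount
    rw [if_neg (by omega), if_neg (by omega), if_pos (by omega)]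
    congr 3
    omega
  have e2 : ∏ i ∈ range t, letterCount L M J f (L + i) = q ^ (t - J.card) := by
    have : ∀ i ∈ range t, letterCount L M J f (L + i) = if i ∈ J then 1 else q := by
      intro i _
      unfold letterCount
      rw [if_neg (by omega), if_neg (by omega), if_neg (by omega), Nat.add_sub_cancel_left]
    rw [prod_congr rfl this, prod_ite, prod_const_one, one_mul, prod_const, filter_not,
      card_sdiff_of_subset (filter_subset _ _), card_range, filter_mem_eq_inter,
      inter_eq_right.2 hJ]
  rw [e1, e2]

/-- The choice of M keeps J + j inside the first half for all j < M: x ≤ t-1 and j ≤ L/2 - t give x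
+ j < L/2. For large t, truncation makes M = 0. -/
theorem card_wordsWithTail_le {q L t M : ℕ} {J : Finset ℕ} (hq : 1 ≤ q) (hJt : J ⊆ range t)
    (hJ : 0 < J.card) (hM : M = L / 2 + 1 - t) :
    ((wordsWithTail q L t J).card : ℝ) ≤ q ^ (t - J.card) *
      (q ^ (L - 2 * M) * (q ^ ((M : ℝ) / J.card) * depthConst q ^ (2 * M))) := by
  have ht : 1 ≤ t := by
    obtain ⟨x, hx⟩ := card_pos.1 hJ
    have := mem_range.1 (hJt hx)
    omega
  have hMh : M ≤ L / 2 := by omega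
  have h1 := card_wordsWithTail_le_sum (q := q) (t := t) (h := L / 2) M J (Nat.div_le_self _ _)
  simp only [prod_letterCount hJt (show L / 2 + M ≤ L by omega)] at h1
  rw [← sum_mul, ← mul_sum] at h1
  have h2 := sum_prod_card_compatibleLetters_le (h := L / 2) hq hJ hMh
    (shiftedIndices (L / 2) J) ?_ (card_filter_mem_shiftedIndices_le J (range M))
  swap
  · intro j hj
    refine card_shiftedIndices fun x hx => ?_
    have := mem_range.1 (hJt hx)
    omega
  have h3 : ((wordsWithTail q L t J).card : ℝ) ≤ q ^ (L - M - L / 2) *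
      (∑ f : DepthWord q (L / 2), ∏ j ∈ range M,
        ((compatibleLetters (shiftedIndices (L / 2) J j) f).card : ℝ)) * q ^ (t - J.card) := by
    exact_mod_cast h1
  refine h3.trans ?_
  have h4 : (q : ℝ) ^ (L - 2 * M) = q ^ (L - M - L / 2) * q ^ (L / 2 - M) := by
    rw [← pow_add]; congr 1; omega
  rw [h4]
  calc _ ≤ (q : ℝ) ^ (L - M - L / 2) * (q ^ (L / 2 - M) *
      (q ^ ((M : ℝ) / J.card) * depthConst q ^ (2 * M))) * q ^ (t - J.card) := by gcongr
    _ = _ := by ring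

theorem ncard_isTailHeavy_le {q L t : ℕ} (hq : 2 ≤ q) (ht : 1 ≤ t) :
    (({w : DepthWord q (L + t) | IsTailHeavy t w}.ncard : ℕ) : ℝ) ≤
      (t : ℝ) * (q : ℝ) ^ t *
        depthConst q ^ (((L + t : ℕ) : ℝ) + Real.sqrt ((L + t : ℕ) : ℝ) + 10) := by
  classical
  have hq1 : (1 : ℝ) ≤ q := by exact_mod_cast (by omega : 1 ≤ q)
  set r := Real.sqrt ((L + t : ℕ) : ℝ) with hr
  obtain ⟨M, hM⟩ : ∃ M, M = L / 2 + 1 - t := ⟨_, rfl⟩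
  have hr0 : 0 < r := Real.sqrt_pos.2 (by exact_mod_cast (by omega : 0 < L + t))
  set 𝒥 := (range t).powerset.filter fun J => r < (J.card : ℝ) with h𝒥
  have hsub : {w : DepthWord q (L + t) | IsTailHeavy t w} ⊆
      ((𝒥.biUnion fun J => wordsWithTail q L t J : Finset _) : Set _) := by
    intro w hw
    obtain ⟨J, hJ, hJr, hwJ⟩ := exists_mem_wordsWithTail hw
    exact mem_coe.2 (mem_biUnion.2 ⟨J, mem_filter.2 ⟨hJ, hJr⟩, hwJ⟩)
  have h1 : {w : DepthWord q (L + t) | IsTailHeavy t w}.ncard ≤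
      ∑ J ∈ 𝒥, (wordsWithTail q L t J).card := by
    refine (Set.ncard_le_ncard hsub (finite_toSet _)).trans ?_
    rw [Set.ncard_coe_finset]
    exact card_biUnion_le
  have hx : (M : ℝ) / r ≤ r / 2 := by
    rw [div_le_iff₀ hr0, div_mul_eq_mul_div, hr, Real.mul_self_sqrt (Nat.cast_nonneg _),
      le_div_iff₀ two_pos]
    exact_mod_cast (by omega : M * 2 ≤ L + t)
  have h2 : ∀ J ∈ 𝒥, ((wordsWithTail q L t J).card : ℝ) ≤ 1 ^ J.card * q ^ (t - J.card) *
      (q ^ (L - 2 * M) * (q ^ ((M : ℝ) / r) * depthConst q ^ (2 * M))) := by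
    intro J hJ
    obtain ⟨hJt, hJr⟩ := mem_filter.1 hJ
    refine (card_wordsWithTail_le (by omega) (mem_powerset.1 hJt)
      (by exact_mod_cast hr0.trans hJr) hM).trans ?_
    have := depthConst_nonneg q
    rw [one_pow, one_mul]
    gcongr
  -- Binomial theorem; the powers of 1 are kept to match its form.
  have h3 : ∑ J ∈ (range t).powerset, (1 : ℝ) ^ J.card * (q : ℝ) ^ (t - J.card) =
      ((q : ℝ) + 1) ^ t := by
    have := sum_pow_mul_eq_add_pow (1 : ℝ) q (range t)
    rw [card_range] at this
    rw [this, add_comm]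
  calc (({w : DepthWord q (L + t) | IsTailHeavy t w}.ncard : ℕ) : ℝ)
      ≤ ∑ J ∈ 𝒥, ((wordsWithTail q L t J).card : ℝ) := by exact_mod_cast h1
    _ ≤ ∑ J ∈ 𝒥, 1 ^ J.card * (q : ℝ) ^ (t - J.card) *
      (q ^ (L - 2 * M) * (q ^ ((M : ℝ) / r) * depthConst q ^ (2 * M))) := sum_le_sum h2
    _ ≤ ((q : ℝ) + 1) ^ t *
      (q ^ (L - 2 * M) * (q ^ ((M : ℝ) / r) * depthConst q ^ (2 * M))) := by
      have := depthConst_nonneg q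
      rw [← sum_mul, ← h3]
      refine mul_le_mul_of_nonneg_right ?_ (by positivity)
      exact sum_le_sum_of_subset_of_nonneg (filter_subset _ _) fun _ _ _ => by positivity
    _ ≤ _ := depth_bound_le hq ht hr0.le hx (by omega) (by omega)

theorem IsTailHeavy.one_le {q ℓ t : ℕ} {w : DepthWord q ℓ} (hw : IsTailHeavy t w) : 1 ≤ t := by
  obtain ⟨I, hI, hIq, -⟩ := hw
  have : 0 < I.card := by exact_mod_cast (Real.sqrt_nonneg _).trans_lt hI
  obtain ⟨i, hi⟩ := card_pos.1 this
  have h1 := (hIq i hi).1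
  have h2 := i.2
  unfold wordPos at h1
  omega

end TailHeavy

theorem mainTheorem2 (q ℓ t : ℕ) (hq : 1 ≤ q) :
    (({w : DepthWord q ℓ | IsTailHeavy t w}.ncard : ℕ) : ℝ) ≤
      (t : ℝ) * (q : ℝ) ^ t * depthConst q ^ ((ℓ : ℝ) + Real.sqrt (ℓ : ℝ) + 10) := by
  have hc := one_le_depthConst hq
  have hq1 : (1 : ℝ) ≤ q := by exact_mod_cast hq
  rcases Set.eq_empty_or_nonempty {w : DepthWord q ℓ | IsTailHeavy t w} with h0 | ⟨w, hw⟩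
  · rw [h0, Set.ncard_empty, Nat.cast_zero]
    positivity
  have ht : 1 ≤ t := IsTailHeavy.one_le hw
  have ht' : (1 : ℝ) ≤ t := by exact_mod_cast ht
  -- For q = 1 the bound c_q ≤ q fails, as c_1 = √2. There, and for t > ℓ, the trivial count q^ℓ ≤
  -- q^t suffices.
  by_cases hmain : 2 ≤ q ∧ t ≤ ℓ
  · obtain ⟨L, rfl⟩ := Nat.exists_eq_add_of_le' hmain.2
    exact ncard_isTailHeavy_le hmain.1 ht
  have hcard : (({w : DepthWord q ℓ | IsTailHeavy t w}.ncard : ℕ) : ℝ) ≤ (q : ℝ) ^ ℓ := by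
    have := Set.ncard_le_ncard (Set.subset_univ {w : DepthWord q ℓ | IsTailHeavy t w})
    rw [Set.ncard_univ, Nat.card_eq_fintype_card] at this
    simp only [Fintype.card_fun, Fintype.card_fin, Fintype.card_coe, Nat.card_Icc,
      Nat.add_sub_cancel] at this
    exact_mod_cast this
  have hpow : (q : ℝ) ^ ℓ ≤ (q : ℝ) ^ t := by
    rcases (by omega : q = 1 ∨ ℓ ≤ t) with rfl | h
    · simp
    · exact pow_le_pow_right₀ hq1 h
  calc _ ≤ (q : ℝ) ^ t := hcard.trans hpow
    _ ≤ (t : ℝ) * (q : ℝ) ^ t := le_mul_of_one_le_left (by positivity) ht'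
    _ ≤ _ := le_mul_of_one_le_right (by positivity) (Real.one_le_rpow hc (by positivity))
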